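/- Consider a bandit with $K$ rested arms. Arm $i$ carries an irreducible Markov chain $M_i$ on $\{0,1\}$ with transition probabilities $p_{01}^i$ (from $0$ to $1$) and $p_{10}^i$ (from $1$ to $0$), not restricted to any parametric family, i.e. any $p_{01}^i,p_{10}^i\in(0,1]$. The arms evolve independently, and an arm makes a transition only when it is played. Playing an arm that is in state $s$ reveals $s$ and pays the reward $s$. The initial state of arm $i$ has a law that may depend on $i$ and on the chain $M_i$, but whose support does not depend on the chain (for instance, a fixed law, or the stationary law). Let $\pi_i$ be the stationary distribution of $M_i$, so that $\pi_i(0)=\frac{p_{10}^i}{p_{01}^i+p_{10}^i}$ and $\pi_i(1)=\frac{p_{01}^i}{p_{01}^i+p_{10}^i}$, and let $\mu_i=\pi_i(1)$ be its mean reward and $\mu^*=\max_i\mu_i$. A (possibly randomized) policy $\alpha$ chooses the arm of round $t$ from the arms played and the rewards obtained in rounds $1,\dots,t-1$. Its regret is $R_\alpha(n)=n\mu^*-\mathbb E_\alpha\big[\text{total reward of rounds }1,\dots,n\big]$. The policy is uniformly good if $R_\alpha(n)=o(n^\beta)$ as $n\to\infty$ for every $\beta>0$ and for every choice of the irreducible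 chains $M_1,\dots,M_K$. For two chains put $$I(M_i\|M_j)=\pi_i(0)\,D(p_{01}^i\|p_{01}^j)+\pi_i(1)\,D(p_{10}^i\|p_{10}^j)\in[0,\infty],\qquad D(A\|B)=A\log\tfrac AB+(1-A)\log\tfrac{1-A}{1-B},$$ with $0\log\frac0y=0$ for every $y\ge 0$ and $x\log\frac x0=\infty$ for $x>0$. Theorem. Let $\alpha$ be a uniformly good policy. Then for all irreducible chains $M_1,\dots,M_K$ and every arm $b$ with $\mu_b=\mu^*$ (after relabelling the arms, $b=1$), with $\Delta_i=\mu_b-\mu_i$, $$\liminf_{n\to\infty}\frac{R_\alpha(n)}{\log n}\;\ge\;\sum_{i\ne b}\frac{\Delta_i}{I(M_i\|M_b)}.$$ The liminf is taken in $[-\infty,\infty]$; a summand with $\Delta_i=0$ or $I(M_i\|M_b)=\infty$ is $0$. -/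

import Mathlib

open Filter Asymptotics
open scoped ENNReal

noncomputable section

namespace MarkovBandit

/-- The transition matrix of the Markov chain on `{0, 1}` that jumps from `0` to `1` with
probability `p01` and from `1` to `0` with probability `p10`. -/
def transMatrix (p01 p10 : ℝ) : Matrix (Fin 2) (Fin 2) ℝ :=
  !![1 - p01, p01; p10, 1 - p10]

/-- An irreducible Markov chain on the state space `{0, 1}`. -/
structure Chain where
  p01 : ℝ
  p10 : ℝ
  p01_mem : p01 ∈ Set.Icc (0 : ℝ) 1
  p10_mem : p10 ∈ Set.Icc (0 : ℝ) 1
  irreducible : (transMatrix p01 p10).IsIrreducible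

/-- For two states, irreducibility means that both jump probabilities are positive. -/
theorem transMatrix_irreducible_iff {p q : ℝ} (hp : p ∈ Set.Icc (0 : ℝ) 1)
    (hq : q ∈ Set.Icc (0 : ℝ) 1) :
    (transMatrix p q).IsIrreducible ↔ 0 < p ∧ 0 < q := by
  have hnn : ∀ i j, 0 ≤ transMatrix p q i j := by
    intro i j
    fin_cases i <;> fin_cases j <;> simp [transMatrix] <;> linarith [hp.1, hp.2, hq.1, hq.2]
  rw [Matrix.isIrreducible_iff_exists_pow_pos hnn]
  constructor
  · intro h
    constructor
    · by_contra hc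
      have h0 : p = 0 := le_antisymm (not_lt.mp hc) hp.1
      obtain ⟨k, -, hk⟩ := h 0 1
      have : ∀ m : ℕ, (transMatrix p q ^ m) 0 1 = 0 := by
        intro m
        induction m with
        | zero => simp
        | succ m ih =>
          rw [pow_succ, Matrix.mul_apply, Fin.sum_univ_two, ih]
          simp [transMatrix, h0]
      rw [this k] at hk
      exact lt_irrefl _ hk
    · by_contra hc
      have h0 : q = 0 := le_antisymm (not_lt.mp hc) hq.1
      obtain ⟨k, -, hk⟩ := h 1 0
      have : ∀ m : ℕ, (transMatrix p q ^ m) 1 0 = 0 := by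
        intro m
        induction m with
        | zero => simp
        | succ m ih =>
          rw [pow_succ, Matrix.mul_apply, Fin.sum_univ_two, ih]
          simp [transMatrix, h0]
      rw [this k] at hk
      exact lt_irrefl _ hk
  · rintro ⟨h1, h2⟩ i j
    have h3 := hp.2
    have h4 := hq.2
    fin_cases i <;> fin_cases j
    · refine ⟨2, by norm_num, ?_⟩
      simp [pow_two, Matrix.mul_apply, Fin.sum_univ_two, transMatrix]
      nlinarith [mul_pos h1 h2, sq_nonneg (1 - p)]
    · exact ⟨1, by norm_num, by simpa [transMatrix] using h1⟩
    · exact ⟨1, by norm_num, by simpa [transMatrix] using h2⟩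
    · refine ⟨2, by norm_num, ?_⟩
      simp [pow_two, Matrix.mul_apply, Fin.sum_univ_two, transMatrix]
      nlinarith [mul_pos h1 h2, sq_nonneg (1 - q)]

/-- The stationary distribution `π` of a chain. -/
def Chain.stat (M : Chain) (s : Fin 2) : ℝ :=
  if s = 0 then M.p10 / (M.p01 + M.p10) else M.p01 / (M.p01 + M.p10)

/-- `Chain.stat` is the unique probability vector that the transition matrix fixes. -/
theorem Chain.eq_stat_iff (M : Chain) (v : Fin 2 → ℝ) :
    v = M.stat ↔
      (∀ s, 0 ≤ v s) ∧ ∑ s, v s = 1 ∧ Matrix.vecMul v (transMatrix M.p01 M.p10) = v := by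
  obtain ⟨h1, h2⟩ := (transMatrix_irreducible_iff M.p01_mem M.p10_mem).1 M.irreducible
  have h3 : M.p01 + M.p10 ≠ 0 := by positivity
  constructor
  · rintro rfl
    refine ⟨?_, ?_, ?_⟩
    · intro s
      unfold Chain.stat
      split_ifs <;> positivity
    · simp [Fin.sum_univ_two, Chain.stat]
      field_simp
      ring
    · funext s
      fin_cases s <;>
        simp [Matrix.vecMul, dotProduct, Fin.sum_univ_two, Chain.stat, transMatrix] <;>
        field_simp <;> ring
  · rintro ⟨-, hs, hv⟩
    have e0 := congrFun hv 0
    simp [Matrix.vecMul, dotProduct, Fin.sum_univ_two, transMatrix] at e0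
    rw [Fin.sum_univ_two] at hs
    funext s
    fin_cases s
    · simp [Chain.stat]
      rw [eq_div_iff h3]
      linear_combination M.p10 * hs - e0
    · simp [Chain.stat]
      rw [eq_div_iff h3]
      linear_combination M.p01 * hs + e0

/-- The mean reward of an arm: state `s` pays the reward `s`. -/
def Chain.mean (M : Chain) : ℝ := ∑ s : Fin 2, ((s : ℕ) : ℝ) * M.stat s

/-- The law of the next state of the chain, given its current state. -/
def Chain.step (M : Chain) (s : Fin 2) : PMF (Fin 2) :=
  PMF.ofFintype (fun t => ENNReal.ofReal (transMatrix M.p01 M.p10 s t)) (by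
    have a := M.p01_mem
    have b := M.p10_mem
    fin_cases s <;> simp only [Fin.sum_univ_two] <;>
      rw [← ENNReal.ofReal_add] <;> simp [transMatrix, a.1, a.2, b.1, b.2])

/-- The relative entropy `D(A‖B) = A log (A/B) + (1-A) log ((1-A)/(1-B))` of two Bernoulli laws
with `A, B ∈ [0, 1]`, with the usual conventions `0 log (0/y) = 0`, `x log (x/0) = ∞` for
`x > 0`. -/
def bernKL (A B : ℝ) : EReal :=
  if (B = 0 ∧ A ≠ 0) ∨ (B = 1 ∧ A ≠ 1) then ⊤
  else ((A * Real.log (A / B) + (1 - A) * Real.log ((1 - A) / (1 - B)) : ℝ) : EReal)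

/-- `I(M‖N) = π_M(0) D(p01^M‖p01^N) + π_M(1) D(p10^M‖p10^N)`. -/
def Chain.kl (M N : Chain) : EReal :=
  (M.stat 0 : EReal) * bernKL M.p01 N.p01 + (M.stat 1 : EReal) * bernKL M.p10 N.p10

variable {K : ℕ}

/-- The list of (arm played, state and hence reward observed), the most recent round first. -/
abbrev History (K : ℕ) := List (Fin K × Fin 2)

/-- A (possibly randomized) policy: the law of the next arm, given the history. -/
abbrev Policy (K : ℕ) := History K → PMF (Fin K)

/-- The initial laws: `init i M` is the law of the state in which arm `i` is found at its first
play, if `M` is its Markov chain. -/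
abbrev InitLaw (K : ℕ) := Fin K → Chain → PMF (Fin 2)

/-- The law of the state in which arm `i` is found if it is played after the history `h`. Arms are
rested: an arm makes one transition from one of its plays to the next and none in between. -/
def stateLaw (init : InitLaw K) (M : Fin K → Chain) (h : History K) (i : Fin K) : PMF (Fin 2) :=
  match h.lookup i with
  | none => init i (M i)
  | some s => (M i).step s

/-- The law of the history of the first `n` rounds under the policy `α`. -/
def histLaw (init : InitLaw K) (α : Policy K) (M : Fin K → Chain) : ℕ → PMF (History K)
  | 0 => PMF.pure []
  | n + 1 => (histLaw init α M n).bind fun h => (α h).bind fun i =>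
      (stateLaw init M h i).map fun s => (i, s) :: h

theorem length_of_mem_support (init : InitLaw K) (α : Policy K) (M : Fin K → Chain) (n : ℕ) :
    ∀ h ∈ (histLaw init α M n).support, h.length = n := by
  induction n with
  | zero =>
    intro h hh
    simp only [histLaw, PMF.support_pure, Set.mem_singleton_iff] at hh
    simp [hh]
  | succ n ih =>
    intro h hh
    simp only [histLaw, PMF.mem_support_bind_iff, PMF.mem_support_map_iff] at hh
    obtain ⟨h', hh', i, -, s, -, rfl⟩ := hh
    simp [ih h' hh']

/-- The total reward collected along a history. -/
def totalReward (h : History K) : ℝ := (h.map fun x => ((x.2 : ℕ) : ℝ)).sum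

/-- The expected total reward of the first `n` rounds. Only the finitely many histories of length
`n` contribute to the sum. -/
def expReward (init : InitLaw K) (α : Policy K) (M : Fin K → Chain) (n : ℕ) : ℝ :=
  ∑' h : History K, (histLaw init α M n h).toReal * totalReward h

/-- The sum that defines `expReward` has finite support. -/
theorem summable_expReward (init : InitLaw K) (α : Policy K) (M : Fin K → Chain) (n : ℕ) :
    Summable fun h : History K => (histLaw init α M n h).toReal * totalReward h := by
  apply summable_of_finite_support
  refine (List.finite_length_eq (Fin K × Fin 2) n).subset ?_
  intro h hh
  refine length_of_mem_support init α M n h ?_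
  rw [PMF.mem_support_iff]
  intro h0
  simp [h0] at hh

/-- The regret `n μ* - E[total reward of the first n rounds]`, with `μ*` the largest mean. -/
def regret (init : InitLaw K) (α : Policy K) (M : Fin K → Chain) (n : ℕ) : ℝ :=
  n * (⨆ i, (M i).mean) - expReward init α M n

/-- A policy is uniformly good if, whatever the irreducible chains of the arms are, its regret is
`o(n ^ β)` for every `β > 0`. -/
def UniformlyGood (init : InitLaw K) (α : Policy K) : Prop :=
  ∀ M : Fin K → Chain, ∀ β : ℝ, 0 < β →
    (fun n : ℕ => regret init α M n) =o[atTop] fun n : ℕ => (n : ℝ) ^ β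

end MarkovBandit

end

noncomputable section

namespace MarkovBandit

variable {K : ℕ}

/-! The proof is a change of measure. Two facts carry it. Bounded correction: for each arm, an
additive functional of its path has expectation (stationary average per transition) × (expected
number of plays) + O(1), uniformly in `n`. This comes from the Poisson equation and a martingale
(`exists_abs_histExp_pathSum_sub_le`). Applied to rewards, it turns the regret into `∑ Δ_i E[N_i]`
up to a constant, where `N_i` counts the plays of arm `i`; applied to log-likelihood ratios, it
gives `E[L] = I · E[N_i] + O(1)`. Change of measure: replace the chain of a suboptimal arm `i` by
one slightly better than `M_b`, at relative entropy close to `I(M_i‖M_b)`. Now `i` is the only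
optimal arm, so uniform goodness leaves `o(n^β)` plays to the others, whereas under the original
chains `i` itself has only `o(n)` plays. The Gibbs inequality `E_M f - E_M L ≤ E_{M'} exp f - 1`,
with `f = (1-β) log n · (1 - N_i/n)`, then forces `I · E[N_i] ≥ (1-β-o(1)) log n`. No concentration
of the likelihood ratio is needed. -/

theorem Chain.p01_pos (M : Chain) : 0 < M.p01 :=
  ((transMatrix_irreducible_iff M.p01_mem M.p10_mem).1 M.irreducible).1

theorem Chain.p10_pos (M : Chain) : 0 < M.p10 :=
  ((transMatrix_irreducible_iff M.p01_mem M.p10_mem).1 M.irreducible).2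

theorem transMatrix_nonneg (M : Chain) (s t : Fin 2) : 0 ≤ transMatrix M.p01 M.p10 s t := by
  have a := M.p01_mem
  have b := M.p10_mem
  fin_cases s <;> fin_cases t <;> simp [transMatrix, a.1, a.2, b.1, b.2]

theorem Chain.step_toReal (M : Chain) (s t : Fin 2) :
    (M.step s t).toReal = transMatrix M.p01 M.p10 s t := by
  simp [Chain.step, ENNReal.toReal_ofReal (transMatrix_nonneg M s t)]

theorem sum_toReal_pmf {ι : Type*} [Fintype ι] (p : PMF ι) : ∑ i, (p i).toReal = 1 := by
  rw [← ENNReal.toReal_sum (fun i _ => p.apply_ne_top i), ← tsum_fintype (L := .unconditional _),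
    p.tsum_coe, ENNReal.toReal_one]

/-! ### Expectations over histories of fixed length. -/

/-- The expectation of a function of the history of the first `n` rounds. -/
def histExp (init : InitLaw K) (α : Policy K) (M : Fin K → Chain) (n : ℕ)
    (f : History K → ℝ) : ℝ :=
  ∑' h : History K, (histLaw init α M n h).toReal * f h

theorem histLaw_eq_zero (init : InitLaw K) (α : Policy K) (M : Fin K → Chain) {n : ℕ}
    {h : History K} (hh : h.length ≠ n) : histLaw init α M n h = 0 := by
  by_contra h0
  exact hh (length_of_mem_support init α M n h ((PMF.mem_support_iff _ _).2 h0))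

theorem histExp_eq_sum (init : InitLaw K) (α : Policy K) (M : Fin K → Chain) (n : ℕ)
    (f : History K → ℝ) :
    histExp init α M n f =
      ∑ h ∈ (List.finite_length_eq (Fin K × Fin 2) n).toFinset,
        (histLaw init α M n h).toReal * f h := by
  refine tsum_eq_sum fun h hh => ?_
  rw [histLaw_eq_zero init α M (by simpa using hh)]
  simp

theorem histExp_mono (init : InitLaw K) (α : Policy K) (M : Fin K → Chain) (n : ℕ)
    {f g : History K → ℝ} (hfg : ∀ h, h.length = n → f h ≤ g h) :
    histExp init α M n f ≤ histExp init α M n g := by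
  rw [histExp_eq_sum, histExp_eq_sum]
  refine Finset.sum_le_sum fun h hh => ?_
  exact mul_le_mul_of_nonneg_left (hfg h (by simpa using hh)) ENNReal.toReal_nonneg

theorem histExp_congr (init : InitLaw K) (α : Policy K) (M : Fin K → Chain) (n : ℕ)
    {f g : History K → ℝ} (hfg : ∀ h, h.length = n → f h = g h) :
    histExp init α M n f = histExp init α M n g :=
  le_antisymm (histExp_mono init α M n fun h hh => (hfg h hh).le)
    (histExp_mono init α M n fun h hh => (hfg h hh).ge)

theorem histExp_const (init : InitLaw K) (α : Policy K) (M : Fin K → Chain) (n : ℕ) (c : ℝ) :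
    histExp init α M n (fun _ => c) = c := by
  rw [histExp, tsum_mul_right, ← ENNReal.tsum_toReal_eq (fun h => PMF.apply_ne_top _ h),
    PMF.tsum_coe, ENNReal.toReal_one, one_mul]

theorem histExp_add (init : InitLaw K) (α : Policy K) (M : Fin K → Chain) (n : ℕ)
    (f g : History K → ℝ) :
    histExp init α M n (fun h => f h + g h) = histExp init α M n f + histExp init α M n g := by
  simp only [histExp_eq_sum, mul_add, Finset.sum_add_distrib]

theorem histExp_sub (init : InitLaw K) (α : Policy K) (M : Fin K → Chain) (n : ℕ)
    (f g : History K → ℝ) :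
    histExp init α M n (fun h => f h - g h) = histExp init α M n f - histExp init α M n g := by
  simp only [histExp_eq_sum, mul_sub, Finset.sum_sub_distrib]

theorem histExp_const_mul (init : InitLaw K) (α : Policy K) (M : Fin K → Chain) (n : ℕ) (c : ℝ)
    (f : History K → ℝ) :
    histExp init α M n (fun h => c * f h) = c * histExp init α M n f := by
  simp only [histExp_eq_sum, Finset.mul_sum, mul_left_comm]

theorem histExp_sum {ι : Type*} (init : InitLaw K) (α : Policy K) (M : Fin K → Chain) (n : ℕ)
    (t : Finset ι) (f : ι → History K → ℝ) :
    histExp init α M n (fun h => ∑ i ∈ t, f i h) = ∑ i ∈ t, histExp init α M n (f i) := by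
  simp only [histExp_eq_sum, Finset.mul_sum]
  exact Finset.sum_comm

theorem histExp_zero (init : InitLaw K) (α : Policy K) (M : Fin K → Chain) (f : History K → ℝ) :
    histExp init α M 0 f = f [] := by
  rw [histExp, tsum_eq_single []]
  · simp [histLaw]
  · intro h hh
    simp [histLaw, hh]

theorem histLaw_succ_cons (init : InitLaw K) (α : Policy K) (M : Fin K → Chain) (n : ℕ)
    (i : Fin K) (s : Fin 2) (h : History K) :
    histLaw init α M (n + 1) ((i, s) :: h) =
      histLaw init α M n h * (α h i * stateLaw init M h i s) := by
  rw [histLaw, PMF.bind_apply, tsum_eq_single h]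
  · rw [PMF.bind_apply, tsum_eq_single i]
    · rw [PMF.map_apply, tsum_eq_single s]
      · simp
      · intro s' hs
        simp [Ne.symm hs]
    · intro i' hi
      simp [PMF.map_apply, Ne.symm hi]
  · intro h' hh
    simp [PMF.bind_apply, PMF.map_apply, Ne.symm hh]

theorem histExp_succ (init : InitLaw K) (α : Policy K) (M : Fin K → Chain) (n : ℕ)
    (f : History K → ℝ) :
    histExp init α M (n + 1) f =
      histExp init α M n fun h => ∑ i, (α h i).toReal *
        ∑ s, (stateLaw init M h i s).toReal * f ((i, s) :: h) := by
  -- A history of length `n + 1` is uniquely a last round put on a history of length `n`, so the sum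
  -- can be reindexed along `cons`.
  have hinj : Function.Injective fun x : History K × (Fin K × Fin 2) => x.2 :: x.1 := by
    rintro ⟨h, x⟩ ⟨h', x'⟩ e
    simp only [List.cons.injEq] at e
    simp [e.1, e.2]
  have hsum : Summable fun h : History K => (histLaw init α M (n + 1) h).toReal * f h := by
    refine summable_of_hasFiniteSupport
      ((List.finite_length_eq (Fin K × Fin 2) (n + 1)).subset fun h hh => ?_)
    by_contra hc
    exact hh (by simp [histLaw_eq_zero init α M hc])
  have hsupp : (Function.support fun h : History K =>
      (histLaw init α M (n + 1) h).toReal * f h) ⊆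
      Set.range fun x : History K × (Fin K × Fin 2) => x.2 :: x.1 := by
    rintro (_ | ⟨x, h⟩) hh
    · exact absurd (by simp [histLaw_eq_zero init α M (n := n + 1) (h := []) (by simp)]) hh
    · exact ⟨(h, x), rfl⟩
  rw [histExp, ← hinj.tsum_eq hsupp]
  refine ((hsum.comp_injective hinj).tsum_prod).trans ?_
  rw [histExp]
  refine tsum_congr fun h => ?_
  rw [tsum_fintype, Fintype.sum_prod_type, Finset.mul_sum]
  refine Finset.sum_congr rfl fun i _ => ?_
  rw [Finset.mul_sum, Finset.mul_sum]
  refine Finset.sum_congr rfl fun s _ => ?_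
  simp only [Function.comp, histLaw_succ_cons, ENNReal.toReal_mul]
  ring

/-- A function of the history whose conditional expectation given the previous round does not
change has a constant expectation. -/
theorem histExp_eq_of_martingale (init : InitLaw K) (α : Policy K) (M : Fin K → Chain)
    (F : History K → ℝ)
    (hF : ∀ h i, ∑ s, (stateLaw init M h i s).toReal * F ((i, s) :: h) = F h) (n : ℕ) :
    histExp init α M n F = F [] := by
  induction n with
  | zero => exact histExp_zero init α M F
  | succ n ih =>
    rw [histExp_succ, ← ih]
    congr 1
    funext h
    simp only [hF, ← Finset.sum_mul, sum_toReal_pmf, one_mul]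

/-! ### Play counts and additive functionals of one arm. -/

/-- The number of plays of arm `i`. -/
def plays (i : Fin K) (h : History K) : ℝ := (h.map fun x => if x.1 = i then (1 : ℝ) else 0).sum

theorem plays_nonneg (i : Fin K) (h : History K) : 0 ≤ plays i h := by
  refine List.sum_nonneg fun x hx => ?_
  obtain ⟨y, -, rfl⟩ := List.mem_map.1 hx
  split_ifs <;> norm_num

theorem sum_plays (h : History K) : ∑ i, plays i h = h.length := by
  induction h with
  | nil => simp [plays]
  | cons x h ih =>
    simp only [plays, List.map_cons, List.sum_cons, Finset.sum_add_distrib, List.length_cons] at *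
    rw [ih]
    simp [add_comm]

theorem histExp_plays_nonneg (init : InitLaw K) (α : Policy K) (M : Fin K → Chain) (i : Fin K)
    (n : ℕ) : 0 ≤ histExp init α M n (plays i) := by
  rw [← histExp_const init α M n 0]
  exact histExp_mono init α M n fun h _ => plays_nonneg i h

/-- The additive functional of the path of arm `i` that charges `c s` for starting in `s` and
`g s t` for a transition from `s` to `t`. -/
def pathSum (i : Fin K) (c : Fin 2 → ℝ) (g : Fin 2 → Fin 2 → ℝ) : History K → ℝ
  | [] => 0
  | (j, s) :: h => pathSum i c g h + if j = i then (h.lookup i).elim (c s) (fun r => g r s) else 0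

theorem totalReward_eq (h : History K) :
    totalReward h =
      ∑ i, pathSum i (fun s => ((s : ℕ) : ℝ)) (fun _ s => ((s : ℕ) : ℝ)) h := by
  induction h with
  | nil => simp [totalReward, pathSum]
  | cons x h ih =>
    obtain ⟨j, s⟩ := x
    simp only [totalReward, List.map_cons, List.sum_cons, pathSum, Finset.sum_add_distrib] at *
    rw [ih, add_comm]
    congr 1
    rw [Finset.sum_eq_single j]
    · cases h.lookup j <;> simp
    · intro i _ hi
      simp [Ne.symm hi]
    · simp

/-- The stationary mean of the transition cost `g`. -/
def Chain.avg (M : Chain) (g : Fin 2 → Fin 2 → ℝ) : ℝ :=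
  ∑ s, M.stat s * ∑ t, transMatrix M.p01 M.p10 s t * g s t

/-- The Poisson equation: the potential `u` compensates the dependence of the centred cost on the
current state. -/
theorem Chain.exists_poisson (M : Chain) (g : Fin 2 → Fin 2 → ℝ) :
    ∃ u : Fin 2 → ℝ, ∀ s,
      ∑ t, transMatrix M.p01 M.p10 s t * (g s t - M.avg g + u t) = u s := by
  have h3 : M.p01 + M.p10 ≠ 0 := (add_pos M.p01_pos M.p10_pos).ne'
  -- Normalise `u 1 = 0`; subtracting the two equations determines `u 0`.
  refine ⟨fun s => if s = 0 then ((∑ t, transMatrix M.p01 M.p10 0 t * g 0 t) -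
    ∑ t, transMatrix M.p01 M.p10 1 t * g 1 t) / (M.p01 + M.p10) else 0, fun s => ?_⟩
  fin_cases s <;> simp [Chain.avg, Chain.stat, Fin.sum_univ_two, transMatrix] <;> field_simp <;>
    ring

/-- Path cost minus average times plays, corrected by the potential of the last seen state, is a
martingale whichever arm the policy picks. The correction is bounded, so the error does not depend
on `n`. -/
theorem exists_abs_histExp_pathSum_sub_le (init : InitLaw K) (α : Policy K) (M : Fin K → Chain)
    (i : Fin K) (c : Fin 2 → ℝ) (g : Fin 2 → Fin 2 → ℝ) :
    ∃ C : ℝ, ∀ n, |histExp init α M n (pathSum i c g) -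
      (M i).avg g * histExp init α M n (plays i)| ≤ C := by
  obtain ⟨u, hu⟩ := (M i).exists_poisson g
  set G := (M i).avg g
  -- The potential of an arm not yet played, chosen so that its first play also preserves the
  -- martingale property.
  set v : ℝ := ∑ s, (init i (M i) s).toReal * (c s - G + u s) with hv
  set V : History K → ℝ := fun h => (h.lookup i).elim v u with hV
  have hbV : ∀ h, |V h| ≤ |v| + (|u 0| + |u 1|) := by
    intro h
    have h0 := abs_nonneg v
    have h1 := abs_nonneg (u 0)
    have h2 := abs_nonneg (u 1)
    simp only [hV]
    rcases h.lookup i with _ | s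
    · simp only [Option.elim]; linarith
    · fin_cases s <;> simp only [Option.elim, Fin.zero_eta, Fin.mk_one] <;> linarith
  have hmart := histExp_eq_of_martingale init α M
    (fun h => pathSum i c g h - G * plays i h + V h) (by
      intro h j
      have hone := sum_toReal_pmf (stateLaw init M h j)
      rw [Fin.sum_univ_two] at hone ⊢
      by_cases hj : j = i
      · subst hj
        simp only [pathSum, plays, List.map_cons, List.sum_cons, hV, List.lookup_cons,
          beq_self_eq_true, if_true, Option.elim_some]
        set A := pathSum j c g h
        set N := (h.map fun x => if x.1 = j then (1 : ℝ) else 0).sum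
        rcases hl : h.lookup j with _ | r
        · simp only [stateLaw, hl, Option.elim] at hone ⊢
          rw [Fin.sum_univ_two] at hv
          linear_combination (A - G * N) * hone - hv
        · have hur := hu r
          simp only [stateLaw, hl, Option.elim] at hone ⊢
          rw [Fin.sum_univ_two, ← Chain.step_toReal, ← Chain.step_toReal] at hur
          linear_combination (A - G * N) * hone + hur
      · have hj' : (i == j) = false := by simp [Ne.symm hj]
        simp only [pathSum, plays, List.map_cons, List.sum_cons, hV, List.lookup_cons, hj',
          if_neg hj]
        simp only [zero_add, add_zero]
        rw [← add_mul, hone, one_mul])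
  refine ⟨|v| + (|v| + (|u 0| + |u 1|)), fun n => ?_⟩
  have e := hmart n
  rw [histExp_add, histExp_sub, histExp_const_mul] at e
  have e0 : pathSum i c g [] - G * plays i [] + V [] = v := by simp [pathSum, plays, hV]
  rw [e0] at e
  have hVn : |histExp init α M n V| ≤ |v| + (|u 0| + |u 1|) := by
    rw [abs_le]
    constructor
    · rw [← histExp_const init α M n (-_)]
      exact histExp_mono init α M n fun h _ => (abs_le.1 (hbV h)).1
    · conv_rhs => rw [← histExp_const init α M n (|v| + (|u 0| + |u 1|))]
      exact histExp_mono init α M n fun h _ => (abs_le.1 (hbV h)).2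
  have : histExp init α M n (pathSum i c g) - G * histExp init α M n (plays i) =
      v - histExp init α M n V := by linarith
  rw [this]
  exact (abs_sub _ _).trans (by linarith)

/-! ### Regret in terms of play counts. -/

theorem Chain.avg_reward (M : Chain) : M.avg (fun _ s => ((s : ℕ) : ℝ)) = M.mean := by
  have h3 : M.p01 + M.p10 ≠ 0 := (add_pos M.p01_pos M.p10_pos).ne'
  simp [Chain.avg, Chain.mean, Chain.stat, Fin.sum_univ_two, transMatrix]
  field_simp
  ring

/-- The play counts sum to `n`, so `n μ*` splits over the arms and only the bounded errors of the
path sums remain. -/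
theorem exists_abs_regret_sub_le (init : InitLaw K) (α : Policy K) (M : Fin K → Chain) (b : Fin K)
    (hb : ∀ i, (M i).mean ≤ (M b).mean) :
    ∃ C : ℝ, ∀ n, |regret init α M n -
      ∑ i, ((M b).mean - (M i).mean) * histExp init α M n (plays i)| ≤ C := by
  choose C hC using fun i => exists_abs_histExp_pathSum_sub_le init α M i
    (fun s => ((s : ℕ) : ℝ)) (fun _ s => ((s : ℕ) : ℝ))
  refine ⟨∑ i, C i, fun n => ?_⟩
  have hsup : (⨆ i, (M i).mean) = (M b).mean :=
    le_antisymm (@ciSup_le _ _ _ ⟨b⟩ _ _ hb)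
      (le_ciSup (f := fun i => (M i).mean) (Set.finite_range _).bddAbove b)
  have hrew : expReward init α M n =
      ∑ i, histExp init α M n (pathSum i (fun s => ((s : ℕ) : ℝ)) (fun _ s => ((s : ℕ) : ℝ))) := by
    rw [← histExp_sum, ← funext totalReward_eq]
    rfl
  have hn : (n : ℝ) = ∑ i, histExp init α M n (plays i) := by
    rw [← histExp_sum, ← histExp_const init α M n (n : ℝ)]
    exact histExp_congr init α M n fun h hh => by rw [sum_plays, hh]
  have : regret init α M n - ∑ i, ((M b).mean - (M i).mean) * histExp init α M n (plays i) =
      -∑ i, (histExp init α M n (pathSum i (fun s => ((s : ℕ) : ℝ)) (fun _ s => ((s : ℕ) : ℝ))) -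
        (M i).mean * histExp init α M n (plays i)) := by
    simp only [regret, hsup, hrew, sub_mul, Finset.sum_sub_distrib, ← Finset.mul_sum, ← hn]
    ring
  rw [this, abs_neg]
  refine (Finset.abs_sum_le_sum_abs _ _).trans (Finset.sum_le_sum fun i _ => ?_)
  rw [← Chain.avg_reward]
  exact hC i n

/-- Under a uniformly good policy, suboptimal arms are played `o(n ^ β)` times. -/
theorem UniformlyGood.isLittleO_plays {init : InitLaw K} {α : Policy K}
    (hα : UniformlyGood init α) (M : Fin K → Chain) (b : Fin K)
    (hb : ∀ i, (M i).mean ≤ (M b).mean) (i : Fin K) (hi : (M i).mean < (M b).mean)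
    {β : ℝ} (hβ : 0 < β) :
    (fun n : ℕ => histExp init α M n (plays i)) =o[atTop] fun n : ℕ => (n : ℝ) ^ β := by
  obtain ⟨C, hC⟩ := exists_abs_regret_sub_le init α M b hb
  have hpow : Tendsto (fun n : ℕ => (n : ℝ) ^ β) atTop atTop :=
    (tendsto_rpow_atTop hβ).comp tendsto_natCast_atTop_atTop
  have hlit : (fun n : ℕ => (regret init α M n + C) / ((M b).mean - (M i).mean))
      =o[atTop] fun n : ℕ => (n : ℝ) ^ β := by
    simp only [div_eq_inv_mul]
    refine ((hα M β hβ).add ?_).const_mul_left _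
    rw [isLittleO_const_left]
    exact Or.inr (tendsto_norm_atTop_atTop.comp hpow)
  have hE : ∀ j n, 0 ≤ histExp init α M n (plays j) := histExp_plays_nonneg init α M
  refine IsBigO.trans_isLittleO (IsBigO.of_bound 1 (Eventually.of_forall fun n => ?_)) hlit
  have hle : histExp init α M n (plays i) ≤
      (regret init α M n + C) / ((M b).mean - (M i).mean) := by
    rw [le_div_iff₀ (sub_pos.2 hi), mul_comm]
    refine (Finset.single_le_sum (f := fun j => ((M b).mean - (M j).mean) *
      histExp init α M n (plays j)) (fun j _ => mul_nonneg (sub_nonneg.2 (hb j)) (hE j n))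
      (Finset.mem_univ i)).trans ?_
    linarith [(abs_le.1 (hC n)).1]
  rw [one_mul, Real.norm_of_nonneg (hE i n)]
  exact hle.trans (le_abs_self _)

/-! ### Change of measure. -/

/-- The log-likelihood ratio of the history for the chain `A` against the chain `B` in arm `i`. -/
def logLik (init : InitLaw K) (i : Fin K) (A B : Chain) : History K → ℝ :=
  pathSum i (fun s => Real.log ((init i A s).toReal / (init i B s).toReal))
    (fun s t => Real.log (transMatrix A.p01 A.p10 s t / transMatrix B.p01 B.p10 s t))

theorem mul_exp_neg_log_div_le {x y : ℝ} (hx : 0 ≤ x) (hy : 0 ≤ y) (hxy : y = 0 → x = 0) :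
    x * Real.exp (-Real.log (x / y)) ≤ y := by
  rcases hx.eq_or_lt with h | h
  · simpa [← h] using hy
  · have hy' : 0 < y := lt_of_le_of_ne hy fun e => h.ne' (hxy e.symm)
    rw [Real.exp_neg, Real.exp_log (div_pos h hy')]
    field_simp
    exact le_rfl

/-- The policy factors agree under both models, and so do the other arms. An inequality suffices:
the new model may charge histories that are null under the old one. -/
theorem toReal_histLaw_mul_exp_le (init : InitLaw K)
    (hinit : ∀ (i : Fin K) (N N' : Chain), (init i N).support = (init i N').support)
    (α : Policy K) (M : Fin K → Chain) (i : Fin K) (B : Chain)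
    (hB : ∀ s t, transMatrix B.p01 B.p10 s t = 0 → transMatrix (M i).p01 (M i).p10 s t = 0)
    (n : ℕ) (h : History K) :
    (histLaw init α M n h).toReal * Real.exp (-logLik init i (M i) B h) ≤
      (histLaw init α (Function.update M i B) n h).toReal := by
  induction n generalizing h with
  | zero => rcases h with _ | ⟨x, h⟩ <;> simp [histLaw, logLik, pathSum]
  | succ n ih =>
    rcases h with _ | ⟨⟨j, s⟩, h⟩
    · rw [histLaw_eq_zero _ _ _ (by simp), histLaw_eq_zero _ _ _ (by simp)]
      simp
    rw [histLaw_succ_cons, histLaw_succ_cons]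
    simp only [ENNReal.toReal_mul]
    have key : (stateLaw init M h j s).toReal * Real.exp (-(if j = i then (h.lookup i).elim
        (Real.log ((init i (M i) s).toReal / (init i B s).toReal))
        (fun r => Real.log (transMatrix (M i).p01 (M i).p10 r s / transMatrix B.p01 B.p10 r s))
        else 0)) ≤ (stateLaw init (Function.update M i B) h j s).toReal := by
      by_cases hj : j = i
      · subst hj
        rcases hl : h.lookup j with _ | r
        · simp only [stateLaw, hl, if_true, Option.elim, Function.update_self]
          refine mul_exp_neg_log_div_le ENNReal.toReal_nonneg ENNReal.toReal_nonneg fun h0 => ?_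
          have h1 : s ∉ (init j B).support := by
            rw [PMF.mem_support_iff, not_not]
            exact ((ENNReal.toReal_eq_zero_iff _).1 h0).resolve_right (PMF.apply_ne_top _ _)
          rw [hinit j B (M j), PMF.mem_support_iff, not_not] at h1
          rw [h1, ENNReal.toReal_zero]
        · simp only [stateLaw, hl, if_true, Option.elim, Function.update_self, Chain.step_toReal]
          exact mul_exp_neg_log_div_le (transMatrix_nonneg _ _ _) (transMatrix_nonneg _ _ _)
            (hB r s)
      · simp [stateLaw, hj]
    calc _ = ((histLaw init α M n h).toReal * Real.exp (-logLik init i (M i) B h)) *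
          ((α h j).toReal * ((stateLaw init M h j s).toReal * Real.exp (-(if j = i then
            (h.lookup i).elim (Real.log ((init i (M i) s).toReal / (init i B s).toReal))
            (fun r => Real.log (transMatrix (M i).p01 (M i).p10 r s /
              transMatrix B.p01 B.p10 r s)) else 0)))) := by
          simp only [logLik, pathSum, neg_add, Real.exp_add]
          ring
      _ ≤ _ := by
          refine mul_le_mul (ih h) (mul_le_mul_of_nonneg_left key ENNReal.toReal_nonneg) ?_
            ENNReal.toReal_nonneg
          positivity

/-- The Gibbs variational inequality for the log-likelihood ratio. -/
theorem histExp_sub_logLik_le (init : InitLaw K)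
    (hinit : ∀ (i : Fin K) (N N' : Chain), (init i N).support = (init i N').support)
    (α : Policy K) (M : Fin K → Chain) (i : Fin K) (B : Chain)
    (hB : ∀ s t, transMatrix B.p01 B.p10 s t = 0 → transMatrix (M i).p01 (M i).p10 s t = 0)
    (n : ℕ) (f : History K → ℝ) :
    histExp init α M n f - histExp init α M n (logLik init i (M i) B) ≤
      histExp init α (Function.update M i B) n (fun h => Real.exp (f h)) - 1 := by
  rw [← histExp_sub]
  conv_rhs => rw [← histExp_const init α M n 1]
  simp only [histExp_eq_sum, ← Finset.sum_sub_distrib]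
  refine Finset.sum_le_sum fun h _ => ?_
  have h1 := Real.add_one_le_exp (f h - logLik init i (M i) B h)
  have h2 := mul_le_mul_of_nonneg_right
    (toReal_histLaw_mul_exp_le init hinit α M i B hB n h) (Real.exp_nonneg (f h))
  have h3 := mul_le_mul_of_nonneg_left h1
    (ENNReal.toReal_nonneg (a := histLaw init α M n h))
  rw [sub_eq_add_neg, Real.exp_add] at h3
  linarith

/-! ### Relative entropy and its perturbation. -/

/-- The average of the log-likelihood ratio of one transition. -/
def Chain.relEnt (A B : Chain) : ℝ :=
  A.avg fun s t => Real.log (transMatrix A.p01 A.p10 s t / transMatrix B.p01 B.p10 s t)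

theorem Chain.relEnt_eq (A B : Chain) :
    A.relEnt B = A.stat 0 * (A.p01 * Real.log (A.p01 / B.p01) +
        (1 - A.p01) * Real.log ((1 - A.p01) / (1 - B.p01))) +
      A.stat 1 * (A.p10 * Real.log (A.p10 / B.p10) +
        (1 - A.p10) * Real.log ((1 - A.p10) / (1 - B.p10))) := by
  simp only [Chain.relEnt, Chain.avg, Fin.sum_univ_two]
  simp only [transMatrix, Matrix.of_apply, Matrix.cons_val', Matrix.cons_val_zero,
    Matrix.cons_val_one, Matrix.cons_val_fin_one]
  ring

/-- Irreducibility excludes a jump probability `0`, so only a jump probability `1` of `B` can make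
the divergence infinite. -/
theorem Chain.kl_eq_or (A B : Chain) :
    A.kl B = ⊤ ∨ (A.kl B = (A.relEnt B : EReal) ∧ (B.p01 = 1 → A.p01 = 1) ∧
      (B.p10 = 1 → A.p10 = 1)) := by
  have h01 := B.p01_pos.ne'
  have h10 := B.p10_pos.ne'
  have hs : ∀ s, 0 < A.stat s := fun s => by
    have := A.p01_pos
    have := A.p10_pos
    unfold Chain.stat
    split_ifs <;> positivity
  have hbot : ∀ (s : Fin 2) (x y : ℝ), (A.stat s : EReal) * bernKL x y ≠ ⊥ := fun s x y => by
    unfold bernKL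
    split_ifs
    · rw [EReal.coe_mul_top_of_pos (hs s)]
      simp
    · rw [← EReal.coe_mul]
      exact EReal.coe_ne_bot _
  unfold Chain.kl
  by_cases h1 : B.p01 = 1 ∧ A.p01 ≠ 1
  · left
    have : bernKL A.p01 B.p01 = ⊤ := if_pos (Or.inr h1)
    rw [this, EReal.coe_mul_top_of_pos (hs 0), EReal.top_add_of_ne_bot (hbot _ _ _)]
  by_cases h2 : B.p10 = 1 ∧ A.p10 ≠ 1
  · left
    have : bernKL A.p10 B.p10 = ⊤ := if_pos (Or.inr h2)
    rw [this, EReal.coe_mul_top_of_pos (hs 1), EReal.add_top_of_ne_bot (hbot _ _ _)]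
  refine Or.inr ⟨?_, by tauto, by tauto⟩
  rw [Chain.relEnt_eq, bernKL, bernKL, if_neg (by tauto), if_neg (by tauto)]
  push_cast
  rfl

theorem Chain.mean_eq (M : Chain) : M.mean = M.p01 / (M.p01 + M.p10) := by
  simp [Chain.mean, Chain.stat]

/-- A chain that `A` is absolutely continuous to can be improved at a small cost in relative
entropy. -/
theorem Chain.exists_mean_lt_relEnt_lt (A B : Chain) (h01 : B.p01 = 1 → A.p01 = 1)
    (h10 : B.p10 = 1 → A.p10 = 1) {J : ℝ} (hJ : A.relEnt B < J) :
    ∃ B' : Chain, B.mean < B'.mean ∧ A.relEnt B' < J ∧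
      ∀ s t, transMatrix B'.p01 B'.p10 s t = 0 → transMatrix A.p01 A.p10 s t = 0 := by
  have hp := B.p01_pos
  have hq := B.p10_pos
  have hq1 := B.p10_mem.2
  have hA := A.p10_pos
  -- Only `p10` is lowered: this raises the mean and creates no new zero transition when `e` is
  -- small.
  set F : ℝ → ℝ := fun e => A.stat 0 * (A.p01 * Real.log (A.p01 / B.p01) +
        (1 - A.p01) * Real.log ((1 - A.p01) / (1 - B.p01))) +
      A.stat 1 * (A.p10 * Real.log (A.p10 / (B.p10 - e)) +
        (1 - A.p10) * Real.log ((1 - A.p10) / (1 - (B.p10 - e)))) with hF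
  have hcont : ContinuousAt F 0 := by
    refine continuousAt_const.add (continuousAt_const.mul (ContinuousAt.add ?_ ?_))
    · refine continuousAt_const.mul (ContinuousAt.log (ContinuousAt.div (by fun_prop)
        (by fun_prop) (by simpa using hq.ne')) ?_)
      simpa using ⟨hA.ne', hq.ne'⟩
    -- At `A.p10 = 1` the term vanishes identically; otherwise absolute continuity gives `B.p10 ≠
    -- 1`, away from the singularity.
    · by_cases h1 : A.p10 = 1
      · simp only [h1, sub_self, zero_mul]
        exact continuousAt_const
      · have h2 : 1 - B.p10 ≠ 0 := fun h => h1 (h10 (by linarith))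
        refine continuousAt_const.mul (ContinuousAt.log (ContinuousAt.div (by fun_prop)
          (by fun_prop) (by simpa using h2)) ?_)
        simpa using ⟨sub_ne_zero.2 (Ne.symm h1), h2⟩
  have hF0 : F 0 < J := by
    rw [Chain.relEnt_eq] at hJ
    simpa [hF] using hJ
  obtain ⟨e, ⟨heJ, heq⟩, he⟩ := ((((hcont.eventually_lt continuousAt_const hF0).and
    (gt_mem_nhds hq)).filter_mono nhdsWithin_le_nhds).and
    (self_mem_nhdsWithin (s := Set.Ioi (0 : ℝ)))).exists
  have hmem : B.p10 - e ∈ Set.Icc (0 : ℝ) 1 := ⟨by linarith, by linarith⟩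
  refine ⟨⟨B.p01, B.p10 - e, B.p01_mem, hmem,
    (transMatrix_irreducible_iff B.p01_mem hmem).2 ⟨hp, by linarith⟩⟩, ?_, ?_, ?_⟩
  · rw [Chain.mean_eq, Chain.mean_eq]
    exact div_lt_div_of_pos_left hp (by dsimp only; linarith) (by dsimp only; linarith)
  · rw [Chain.relEnt_eq]
    exact heJ
  · intro s t
    fin_cases s <;> fin_cases t <;> simp [transMatrix] <;> intro h
    · rw [h01 (by linarith), sub_self]
    · linarith
    · linarith
    · linarith

/-! ### Logarithmic lower bound on the plays of a suboptimal arm. -/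

theorem exp_mul_le {θ y : ℝ} (h0 : 0 ≤ θ) (h1 : θ ≤ 1) :
    Real.exp (y * θ) ≤ 1 + θ * Real.exp y := by
  have := convexOn_exp.2 (Set.mem_univ (0 : ℝ)) (Set.mem_univ y) (sub_nonneg.2 h1) h0 (by ring)
  simp only [smul_eq_mul, mul_zero, zero_add, Real.exp_zero, mul_one] at this
  rw [mul_comm]
  linarith

theorem plays_le_length (i : Fin K) (h : History K) : plays i h ≤ h.length := by
  rw [← sum_plays h]
  exact Finset.single_le_sum (f := fun j => plays j h) (fun j _ => plays_nonneg j h)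
    (Finset.mem_univ i)

/-- If arm `i` becomes the only optimal arm when its chain is replaced by `B`, it has to be played
often. -/
theorem UniformlyGood.eventually_le_plays {init : InitLaw K} {α : Policy K}
    (hα : UniformlyGood init α)
    (hinit : ∀ (i : Fin K) (N N' : Chain), (init i N).support = (init i N').support)
    (M : Fin K → Chain) (b : Fin K) (hb : ∀ i, (M i).mean ≤ (M b).mean) (i : Fin K)
    (hi : (M i).mean < (M b).mean) (B : Chain) (hBm : (M b).mean < B.mean)
    (hB : ∀ s t, transMatrix B.p01 B.p10 s t = 0 → transMatrix (M i).p01 (M i).p10 s t = 0)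
    {J x : ℝ} (hJ : (M i).relEnt B ≤ J) (hJ0 : 0 < J) (hx : x * J < 1) :
    ∀ᶠ n : ℕ in atTop, x * Real.log n ≤ histExp init α M n (plays i) := by
  obtain ⟨C, hC⟩ := exists_abs_histExp_pathSum_sub_le init α M i
    (fun s => Real.log ((init i (M i) s).toReal / (init i B s).toReal))
    (fun s t => Real.log (transMatrix (M i).p01 (M i).p10 s t / transMatrix B.p01 B.p10 s t))
  obtain ⟨β, hβ0, hβ⟩ : ∃ β, 0 < β ∧ β < 1 - x * J := exists_between (by linarith)
  set M' := Function.update M i B with hM'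
  have hMi : M' i = B := Function.update_self ..
  have hMj : ∀ j, j ≠ i → (M' j).mean < (M' i).mean := fun j hj => by
    rw [hMi, hM', Function.update_of_ne hj]
    exact (hb j).trans_lt hBm
  have hsmall : ∀ᶠ n : ℕ in atTop,
      ∑ j ∈ Finset.univ.erase i, histExp init α M' n (plays j) ≤ (n : ℝ) ^ β := by
    have : (fun n : ℕ => ∑ j ∈ Finset.univ.erase i, histExp init α M' n (plays j))
        =o[atTop] fun n : ℕ => (n : ℝ) ^ β := by
      refine IsLittleO.fun_sum fun j hj => hα.isLittleO_plays M' i (fun k => ?_) j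
        (hMj j (Finset.ne_of_mem_erase hj)) hβ0
      rcases eq_or_ne k i with rfl | hk
      exacts [le_rfl, (hMj k hk).le]
    filter_upwards [this.bound one_pos] with n hn
    rw [one_mul, Real.norm_of_nonneg (Real.rpow_nonneg n.cast_nonneg β)] at hn
    exact (le_abs_self _).trans hn
  have hlog : Tendsto (fun n : ℕ => Real.log n) atTop atTop :=
    Real.tendsto_log_atTop.comp tendsto_natCast_atTop_atTop
  have hdiv : Tendsto (fun n : ℕ => histExp init α M n (plays i) / n) atTop (nhds 0) := by
    simpa using (hα.isLittleO_plays M b hb i hi one_pos).tendsto_div_nhds_zero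
  -- `C` is the error of the log-likelihood; the `1` is what the Gibbs inequality leaves once
  -- `E_{M'} exp f ≤ 2`.
  have hlim : Tendsto (fun n : ℕ => (1 - β) * (1 - histExp init α M n (plays i) / n) -
      (C + 1) / Real.log n) atTop (nhds ((1 - β) * (1 - 0) - 0)) :=
    ((tendsto_const_nhds.sub hdiv).const_mul _).sub (tendsto_const_nhds.div_atTop hlog)
  filter_upwards [hsmall, hlim.eventually_const_lt (show x * J < _ by linarith),
    hlog.eventually_gt_atTop 0, eventually_gt_atTop 0] with n hn hn2 hln hn0
  have hn0' : (0 : ℝ) < n := Nat.cast_pos.2 hn0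
  have hgibbs := histExp_sub_logLik_le init hinit α M i B hB n
    (fun h => (1 - β) * Real.log n * (1 - plays i h / n))
  have hP : histExp init α M n (fun h => (1 - β) * Real.log n * (1 - plays i h / n)) =
      (1 - β) * Real.log n * (1 - histExp init α M n (plays i) / n) := by
    simp only [div_eq_inv_mul]
    rw [histExp_const_mul, histExp_sub, histExp_const, histExp_const_mul]
  -- By convexity, `exp f ≤ 1 + n^(1-β) (1 - N_i/n)`, and `n (1 - N_i/n)` counts the plays of the
  -- other arms, of expectation at most `n^β` under `M'`.
  have hQ : histExp init α M' n
      (fun h => Real.exp ((1 - β) * Real.log n * (1 - plays i h / n))) ≤ 2 := by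
    have hexp : Real.exp ((1 - β) * Real.log n) = n * ((n : ℝ) ^ β)⁻¹ := by
      rw [mul_comm, ← Real.rpow_def_of_pos hn0', Real.rpow_sub hn0', Real.rpow_one, div_eq_mul_inv]
    have h1 : histExp init α M' n
        (fun h => Real.exp ((1 - β) * Real.log n * (1 - plays i h / n))) ≤
        histExp init α M' n
          (fun h => 1 + ((n : ℝ) ^ β)⁻¹ * ∑ j ∈ Finset.univ.erase i, plays j h) := by
      refine histExp_mono init α M' n fun h hh => ?_
      have hle := plays_le_length i h
      rw [hh] at hle
      have hsum := sum_plays h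
      rw [← Finset.add_sum_erase _ _ (Finset.mem_univ i), hh] at hsum
      refine (exp_mul_le (sub_nonneg.2 ((div_le_one hn0').2 hle))
        (sub_le_self _ (div_nonneg (plays_nonneg i h) hn0'.le))).trans (le_of_eq ?_)
      rw [hexp, eq_sub_of_add_eq' hsum]
      field_simp
    rw [histExp_add, histExp_const, histExp_const_mul, histExp_sum] at h1
    have h2 : ((n : ℝ) ^ β)⁻¹ * ∑ j ∈ Finset.univ.erase i, histExp init α M' n (plays j) ≤ 1 := by
      rw [inv_mul_le_one₀ (Real.rpow_pos_of_pos hn0' β)]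
      exact hn
    linarith
  have hL := (abs_le.1 (hC n)).2
  change histExp init α M n (logLik init i (M i) B) - (M i).relEnt B * _ ≤ C at hL
  have hE : 0 ≤ histExp init α M n (plays i) := histExp_plays_nonneg init α M i n
  have hJE := mul_le_mul_of_nonneg_right hJ hE
  have hn3 := mul_le_mul_of_nonneg_right hn2.le hln.le
  rw [sub_mul, div_mul_cancel₀ _ hln.ne'] at hn3
  rw [hP] at hgibbs
  refine le_of_mul_le_mul_left ?_ hJ0
  linarith

end MarkovBandit

end

/-! ### Summation over the arms. -/

theorem mainTheorem3 {K : ℕ} (init : MarkovBandit.InitLaw K)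
    (hinit : ∀ (i : Fin K) (N N' : MarkovBandit.Chain),
      (init i N).support = (init i N').support)
    (α : MarkovBandit.Policy K) (hα : MarkovBandit.UniformlyGood init α)
    (M : Fin K → MarkovBandit.Chain) (b : Fin K) (hb : ∀ i, (M i).mean ≤ (M b).mean) :
    ∑ i ∈ Finset.univ.erase b,
        (((M b).mean - (M i).mean : ℝ) : EReal) / (M i).kl (M b) ≤
      liminf (fun n : ℕ => ((MarkovBandit.regret init α M n / Real.log n : ℝ) : EReal)) atTop := by
  open MarkovBandit in
  obtain ⟨C, hC⟩ := exists_abs_regret_sub_le init α M b hb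
  have hlog : Tendsto (fun n : ℕ => Real.log n) atTop atTop :=
    Real.tendsto_log_atTop.comp tendsto_natCast_atTop_atTop
  have hE : ∀ j n, 0 ≤ histExp init α M n (plays j) := histExp_plays_nonneg init α M
  have hterm : ∀ i, ∃ c : ℝ, (((M b).mean - (M i).mean : ℝ) : EReal) / (M i).kl (M b) = c ∧
      ∀ c' < c, ∀ᶠ n : ℕ in atTop,
        c' * Real.log n ≤ ((M b).mean - (M i).mean) * histExp init α M n (plays i) := by
    intro i
    have htriv : ∀ c ≤ (0 : ℝ), ∀ c' < c, ∀ᶠ n : ℕ in atTop,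
        c' * Real.log n ≤ ((M b).mean - (M i).mean) * histExp init α M n (plays i) := by
      intro c hc c' hc'
      filter_upwards [hlog.eventually_ge_atTop 0] with n hn
      exact (mul_nonpos_of_nonpos_of_nonneg (hc'.le.trans hc) hn).trans
        (mul_nonneg (sub_nonneg.2 (hb i)) (hE i n))
    rcases (M i).kl_eq_or (M b) with hkl | ⟨hkl, h01, h10⟩
    · exact ⟨0, by simp [hkl], htriv 0 le_rfl⟩
    refine ⟨((M b).mean - (M i).mean) / (M i).relEnt (M b), by rw [hkl, EReal.coe_div], ?_⟩
    rcases (hb i).eq_or_lt with hi | hi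
    · exact htriv _ (by simp [hi])
    -- Strict positivity of the relative entropy need not be proved: otherwise the real quotient is
    -- at most `0`, also under division by zero.
    rcases le_or_gt ((M i).relEnt (M b)) 0 with hI | hI
    · exact htriv _ (div_nonpos_of_nonneg_of_nonpos (sub_nonneg.2 hi.le) hI)
    intro c' hc'
    have hΔ := sub_pos.2 hi
    set I := (M i).relEnt (M b)
    have hx : c' / ((M b).mean - (M i).mean) * I < 1 := by
      rw [div_mul_eq_mul_div, div_lt_one hΔ]
      exact (lt_div_iff₀ hI).1 hc'
    have hcont : ContinuousAt (fun J => c' / ((M b).mean - (M i).mean) * J) I := by fun_prop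
    obtain ⟨J, hxJ, hIJ⟩ := (((hcont.eventually_lt continuousAt_const hx).filter_mono
      nhdsWithin_le_nhds).and (self_mem_nhdsWithin (s := Set.Ioi I))).exists
    obtain ⟨B, hBm, hBJ, hB⟩ := (M i).exists_mean_lt_relEnt_lt (M b) h01 h10 hIJ
    filter_upwards [hα.eventually_le_plays hinit M b hb i hi B hBm hB hBJ.le (hI.trans hIJ) hxJ]
      with n hn
    have := mul_le_mul_of_nonneg_left hn hΔ.le
    rwa [← mul_assoc, mul_div_cancel₀ _ hΔ.ne'] at this
  choose c hc hc' using hterm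
  have hsum : ∑ i ∈ Finset.univ.erase b,
      (((M b).mean - (M i).mean : ℝ) : EReal) / (M i).kl (M b) =
      ((∑ i ∈ Finset.univ.erase b, c i : ℝ) : EReal) := by
    rw [show ((∑ i ∈ Finset.univ.erase b, c i : ℝ) : EReal) =
      ∑ i ∈ Finset.univ.erase b, (c i : EReal) from
        map_sum (⟨⟨Real.toEReal, EReal.coe_zero⟩, EReal.coe_add⟩ : ℝ →+ EReal) c _]
    exact Finset.sum_congr rfl fun i _ => hc i
  rw [hsum]
  refine EReal.ge_of_forall_gt_iff_ge.1 fun z hz => ?_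
  rw [EReal.coe_lt_coe_iff] at hz
  -- At most `K` losses of `ε` come from the arms, one more absorbs `C ≤ ε log n`.
  obtain ⟨ε, hε, hεz⟩ : ∃ ε > 0, z + ε * (K + 1) < ∑ i ∈ Finset.univ.erase b, c i := by
    refine ⟨((∑ i ∈ Finset.univ.erase b, c i) - z) / (2 * (K + 1)),
      div_pos (sub_pos.2 hz) (by positivity), ?_⟩
    field_simp
    linarith
  refine le_liminf_of_le (by isBoundedDefault) ?_
  filter_upwards [eventually_all.2 fun i => hc' i (c i - ε) (by linarith),
    hlog.eventually_gt_atTop 0, hlog.eventually_ge_atTop (C / ε)] with n hn hln hCn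
  rw [EReal.coe_le_coe_iff, le_div_iff₀ hln]
  have h1 : ∑ i ∈ Finset.univ.erase b, (c i - ε) * Real.log n ≤
      ∑ i, ((M b).mean - (M i).mean) * histExp init α M n (plays i) :=
    (Finset.sum_le_sum fun i _ => hn i).trans (Finset.sum_le_sum_of_subset_of_nonneg
      (Finset.erase_subset _ _) fun i _ _ => mul_nonneg (sub_nonneg.2 (hb i)) (hE i n))
  rw [← Finset.sum_mul, Finset.sum_sub_distrib, Finset.sum_const, nsmul_eq_mul] at h1
  have hcard : ((Finset.univ.erase b).card : ℝ) ≤ K := by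
    exact_mod_cast (Finset.card_le_univ _).trans (Fintype.card_fin K).le
  have h2 := (abs_le.1 (hC n)).1
  rw [div_le_iff₀ hε] at hCn
  have h3 := mul_le_mul_of_nonneg_right hεz.le hln.le
  have h4 := mul_le_mul_of_nonneg_right (mul_le_mul_of_nonneg_right hcard hε.le) hln.le
  linarith
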